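/- Let $q\in(0,1)$, $k\in\mathbb R\setminus\{0\}$ and $x_0=(x_0^1,x_0^2,x_0^3)\in\mathbb R^3$. For $p>0$ let $$I^{p}g(t)=\frac1{\Gamma(p)}\int_0^t (t-s)^{p-1}g(s)\,ds ,$$ and let $D_t^q g(t)=I^{1-q}g'(t)$ be the Caputo derivative of order $q$. Consider the initial value problem of the 2-dimensional fractional-order Toda lattice with one control, $$\begin{cases} D_t^q x^1(t)= x^1(t)\,(-x^2(t)+x^3(t)),\\ D_t^q x^2(t)=2\,(x^1(t))^2,\\ D_t^q x^3(t)=-2\,(x^1(t))^2-k\,x^3(t),\end{cases}\qquad x(0)=x_0 .$$ A solution on $[0,\tau)$ is a function $x=(x^1,x^2,x^3):[0,\tau)\to\mathbb R^3$ with $x(0)=x_0$ whose components are absolutely continuous on $[0,T]$ for every $0<T<\tau$, and such that for every $t\in(0,\tau)$ the integrals defining $D_t^q x^i(t)$, $i=1,2,3$, converge absolutely and the three equations hold. Then the initial value problem has a unique solution, local in time: there are $\tau>0$ and a solution on $[0,\tau)$; and for every $T>0$, any two solutions on $[0,T)$ coincide on $[0,T)$. -/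

import Mathlib

/-- The Riemann-Liouville integral `(1 / Γ(p)) ∫₀ᵗ (t - s)^(p - 1) f(s) ds` of order `p > 0`. -/
noncomputable def rlIntegral (p : ℝ) (f : ℝ → ℝ) (t : ℝ) : ℝ :=
  (1 / Real.Gamma p) * ∫ s in (0 : ℝ)..t, (t - s) ^ (p - 1) * f s

/-- The Caputo derivative of order `q ∈ (0, 1)` of `f` at the time `t > 0` exists and equals `d`:
the integral that defines `I^(1 - q) f'` at `t` converges absolutely, and `(I^(1 - q) f')(t) = d`. -/
def HasCaputoDerivAt (q : ℝ) (f : ℝ → ℝ) (d t : ℝ) : Prop :=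
  IntervalIntegrable (fun s => (t - s) ^ ((1 - q) - 1) * deriv f s) MeasureTheory.volume 0 t ∧
    rlIntegral (1 - q) (deriv f) t = d

/-- The right-hand side of the two-dimensional Toda lattice with one linear control.
The coordinates `x¹, x², x³` are `x 0, x 1, x 2`. -/
def todaField (k : ℝ) (x : Fin 3 → ℝ) : Fin 3 → ℝ :=
  ![x 0 * (-x 1 + x 2), 2 * x 0 ^ 2, -2 * x 0 ^ 2 - k * x 2]

/-- `x` solves on `[0, τ)` the initial value problem, with value `x₀` at time `0`, of the fractional
Toda lattice of order `q` with control `k`. Every component is absolutely continuous on the compact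
intervals `[0, T]` with `T < τ`, so that it has an integrable derivative almost everywhere of which
it is the integral, and the system holds at every time in `(0, τ)`. -/
structure IsTodaSolution (q k : ℝ) (x₀ : Fin 3 → ℝ) (τ : ℝ) (x : ℝ → Fin 3 → ℝ) : Prop where
  absCont : ∀ i, ∀ T ∈ Set.Ioo 0 τ, AbsolutelyContinuousOnInterval (fun t => x t i) 0 T
  init : x 0 = x₀
  eqn : ∀ i, ∀ t ∈ Set.Ioo 0 τ,
    HasCaputoDerivAt q (fun s => x s i) (todaField k (x t) i) t

open MeasureTheory ProbabilityTheory Set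

/-! Uniqueness: on absolutely continuous functions `I^q` recovers f - f(0) from the Caputo
derivative of f, because the Abel kernels of orders q and 1 - q compose to a constant
(`integral_abel_kernel_comp`). A solution therefore satisfies a Volterra equation with kernel (t -
s)^(q - 1). The field is locally Lipschitz, so the distance between two solutions obeys a
homogeneous singular Gronwall inequality and vanishes (`eqOn_zero_of_le_integral_abel_kernel`).

Existence: seek x(t) = ∑ a_n t^(nq). The field is a quadratic polynomial, so Cauchy products turn
the system into a recursion for the coefficients (`todaCoeff`). Catalan numbers control its
convolutions (`abs_todaCauchy_le`), so a_n grows at most geometrically and the series converges for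
small t. The series also provides an integrable derivative explicitly, hence the absolute continuity
that a solution of the Volterra equation does not show at once. -/

/-! ### Beta integrals and inversion of the Caputo derivative. -/

/-- **Euler's beta integral** on an arbitrary interval. -/
theorem integral_sub_rpow_mul_sub_rpow {a b r t : ℝ} (ha : 0 < a) (hb : 0 < b) (hrt : r < t) :
    ∫ s in r..t, (t - s) ^ (a - 1) * (s - r) ^ (b - 1) = beta a b * (t - r) ^ (a + b - 1) := by
  have ht : 0 < t - r := sub_pos.2 hrt
  have key : ∫ s in (0 : ℝ)..(t - r), (t - r - s) ^ (a - 1) * s ^ (b - 1) =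
      beta a b * (t - r) ^ (a + b - 1) := by
    have h := Complex.betaIntegral_scaled b a ht
    rw [Complex.betaIntegral_eq_Gamma_mul_div _ _ (by simpa) (by simpa)] at h
    apply Complex.ofReal_injective
    rw [← intervalIntegral.integral_ofReal]
    convert! h using 1
    · refine intervalIntegral.integral_congr fun s hs => ?_
      rw [uIcc_of_le ht.le] at hs
      simp only [Complex.ofReal_mul]
      rw [Complex.ofReal_cpow (sub_nonneg.2 hs.2), Complex.ofReal_cpow hs.1]
      push_cast
      ring
    · rw [beta]
      push_cast [Complex.ofReal_cpow ht.le, ← Complex.Gamma_ofReal]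
      rw [show (b : ℂ) + a = a + b by ring]
      ring
  rw [← key]
  have := intervalIntegral.integral_comp_sub_right (a := r) (b := t)
    (fun s => (t - r - s) ^ (a - 1) * s ^ (b - 1)) r
  simpa using this

theorem intervalIntegrable_sub_rpow_mul_sub_rpow {a b r t : ℝ} (ha : 0 < a) (hb : 0 < b)
    (hrt : r < t) :
    IntervalIntegrable (fun s => (t - s) ^ (a - 1) * (s - r) ^ (b - 1)) volume r t := by
  -- A non-integrable function has integral 0 by convention, so the positive value already computed
  -- proves integrability.
  apply intervalIntegral.intervalIntegrable_of_integral_ne_zero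
  rw [integral_sub_rpow_mul_sub_rpow ha hb hrt]
  have := beta_pos ha hb
  have := Real.rpow_pos_of_pos (sub_pos.2 hrt) (a + b - 1)
  positivity

theorem integrable_tsum_of_summable_integral_norm {α ι : Type*} [MeasurableSpace α] [Countable ι]
    {μ : Measure α} {F : ι → α → ℝ} (hF_int : ∀ i, Integrable (F i) μ)
    (hF_sum : Summable fun i => ∫ a, ‖F i a‖ ∂μ) : Integrable (fun a => ∑' i, F i a) μ := by
  refine ⟨(AEMeasurable.tsum fun i => (hF_int i).aemeasurable).aestronglyMeasurable, ?_⟩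
  have h (i : ι) : ∫⁻ a, ‖F i a‖ₑ ∂μ = ENNReal.ofReal (∫ a, ‖F i a‖ ∂μ) :=
    (ofReal_integral_norm_eq_lintegral_enorm (hF_int i)).symm
  calc ∫⁻ a, ‖∑' i, F i a‖ₑ ∂μ ≤ ∫⁻ a, ∑' i, ‖F i a‖ₑ ∂μ :=
        lintegral_mono fun a => enorm_tsum_le_tsum_enorm
    _ = ∑' i, ENNReal.ofReal (∫ a, ‖F i a‖ ∂μ) := by
        rw [lintegral_tsum fun i => (hF_int i).1.enorm]
        simp_rw [h]
    _ < ⊤ := hF_sum.tsum_ofReal_lt_top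

/-- Dirichlet's formula for the composition of two complementary Abel kernels. -/
theorem integral_abel_kernel_comp {q t : ℝ} (hq0 : 0 < q) (hq1 : q < 1) (ht : 0 < t) {φ : ℝ → ℝ}
    (hφ : IntervalIntegrable φ volume 0 t) :
    ∫ s in (0 : ℝ)..t, (t - s) ^ (q - 1) * ∫ u in (0 : ℝ)..s, (s - u) ^ ((1 - q) - 1) * φ u =
      beta q (1 - q) * ∫ u in (0 : ℝ)..t, φ u := by
  have hq1' : 0 < 1 - q := sub_pos.2 hq1
  set μ : Measure ℝ := volume.restrict (Ioc 0 t) with hμ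
  have hφ' : Integrable φ μ := (intervalIntegrable_iff_integrableOn_Ioc_of_le ht.le).1 hφ
  let k : ℝ → ℝ → ℝ := fun u s => (Ioi u).indicator
    (fun s => (t - s) ^ (q - 1) * (s - u) ^ ((1 - q) - 1)) s
  have kint (g : ℝ → ℝ) (u : ℝ) (hu : u ∈ Ioo 0 t) :
      ∫ s, (Ioi u).indicator g s ∂μ = ∫ s in u..t, g s := by
    rw [hμ, setIntegral_indicator measurableSet_Ioi, intervalIntegral.integral_of_le hu.2.le]
    congr 2
    ext s
    simp only [mem_inter_iff, mem_Ioc, mem_Ioi]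
    exact ⟨fun h => ⟨h.2, h.1.2⟩, fun h => ⟨⟨hu.1.trans h.1, h.2⟩, h.1⟩⟩
  -- The exponent q + (1 - q) - 1 is 0, so the mass of the kernel does not depend on u.
  have kval (u : ℝ) (hu : u ∈ Ioo 0 t) : ∫ s, k u s ∂μ = beta q (1 - q) := by
    rw [kint _ u hu, integral_sub_rpow_mul_sub_rpow hq0 hq1' hu.2]
    simp
  have knn (u s : ℝ) (hs : s ≤ t) : 0 ≤ k u s := by
    refine indicator_apply_nonneg fun hs' => mul_nonneg ?_ ?_
    · exact Real.rpow_nonneg (sub_nonneg.2 hs) _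
    · exact Real.rpow_nonneg (sub_nonneg.2 (le_of_lt hs')) _
  have kmeas : Measurable (fun p : ℝ × ℝ => k p.2 p.1) := by
    have : (fun p : ℝ × ℝ => k p.2 p.1) = {p : ℝ × ℝ | p.2 < p.1}.indicator
        (fun p => (t - p.1) ^ (q - 1) * (p.1 - p.2) ^ ((1 - q) - 1)) := by
      ext p
      simp [k, indicator]
    rw [this]
    exact Measurable.indicator (by fun_prop) (measurableSet_lt measurable_snd measurable_fst)
  have hae : ∀ᵐ u ∂μ, u ∈ Ioo 0 t := by
    rw [hμ, ← restrict_Ioo_eq_restrict_Ioc]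
    exact ae_restrict_mem measurableSet_Ioo
  have hint : Integrable (Function.uncurry fun s u => k u s * φ u) (μ.prod μ) := by
    refine (integrable_prod_iff' ?_).2 ⟨?_, ?_⟩
    · exact kmeas.aestronglyMeasurable.mul hφ'.1.comp_snd
    · filter_upwards [hae] with u hu
      have : Integrable (k u) μ := by
        apply Integrable.of_integral_ne_zero
        rw [kval u hu]
        exact (beta_pos hq0 hq1').ne'
      exact this.mul_const (φ u)
    · refine (hφ'.norm.const_mul (beta q (1 - q))).congr ?_
      filter_upwards [hae] with u hu
      simp only [Function.uncurry, norm_mul]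
      rw [integral_mul_const]
      congr 1
      rw [← kval u hu]
      refine setIntegral_congr_fun measurableSet_Ioc fun s hs => ?_
      exact (Real.norm_of_nonneg (knn u s hs.2)).symm
  have hswap := integral_integral_swap hint
  have hL : ∫ s, ∫ u, k u s * φ u ∂μ ∂μ =
      ∫ s in (0 : ℝ)..t, (t - s) ^ (q - 1) * ∫ u in (0 : ℝ)..s, (s - u) ^ ((1 - q) - 1) * φ u := by
    rw [intervalIntegral.integral_of_le ht.le]
    refine setIntegral_congr_fun measurableSet_Ioc fun s hs => ?_
    rw [← intervalIntegral.integral_const_mul, intervalIntegral.integral_of_le hs.1.le,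
      integral_Ioc_eq_integral_Ioo (y := s)]
    have : Ioo 0 s = Ioc 0 t ∩ Iio s := by
      ext u
      simp only [mem_inter_iff, mem_Ioc, mem_Iio, mem_Ioo]
      exact ⟨fun h => ⟨⟨h.1, h.2.le.trans hs.2⟩, h.2⟩, fun h => ⟨h.1.1, h.2⟩⟩
    rw [this, ← setIntegral_indicator measurableSet_Iio]
    refine integral_congr_ae (.of_forall fun u => ?_)
    by_cases hus : u < s <;> simp [k, indicator, hus, mul_assoc]
  have hR : ∫ u, ∫ s, k u s * φ u ∂μ ∂μ = beta q (1 - q) * ∫ u in (0 : ℝ)..t, φ u := by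
    rw [intervalIntegral.integral_of_le ht.le, ← integral_const_mul]
    refine integral_congr_ae ?_
    filter_upwards [hae] with u hu
    rw [integral_mul_const, kval u hu]
  rw [← hL, hswap, hR]

/-- An absolutely continuous function is recovered from its Caputo derivative by the
Riemann-Liouville integral of the same order. -/
theorem AbsolutelyContinuousOnInterval.rlIntegral_caputo {q t : ℝ} (hq0 : 0 < q) (hq1 : q < 1)
    (ht : 0 < t) {f g : ℝ → ℝ} (hf : AbsolutelyContinuousOnInterval f 0 t)
    (hg : ∀ s ∈ Ioo 0 t, HasCaputoDerivAt q f (g s) s) :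
    rlIntegral q g t = f t - f 0 := by
  have hq1' : 0 < 1 - q := sub_pos.2 hq1
  have h := integral_abel_kernel_comp hq0 hq1 ht hf.intervalIntegrable_deriv
  rw [hf.integral_deriv_eq_sub] at h
  have e : ∫ s in (0 : ℝ)..t, (t - s) ^ (q - 1) * g s = 1 / Real.Gamma (1 - q) *
      ∫ s in (0 : ℝ)..t, (t - s) ^ (q - 1) *
        ∫ u in (0 : ℝ)..s, (s - u) ^ ((1 - q) - 1) * deriv f u := by
    rw [← intervalIntegral.integral_const_mul, intervalIntegral.integral_of_le ht.le,
      intervalIntegral.integral_of_le ht.le, ← restrict_Ioo_eq_restrict_Ioc]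
    refine setIntegral_congr_fun measurableSet_Ioo fun s hs => ?_
    simp only [← (hg s hs).2, rlIntegral]
    ring
  rw [rlIntegral, e, h, beta]
  have h1 := (Real.Gamma_pos_of_pos hq0).ne'
  have h2 := (Real.Gamma_pos_of_pos hq1').ne'
  simp only [add_sub_cancel, Real.Gamma_one]
  field_simp

/-! ### Singular Gronwall inequality and uniqueness. -/

theorem intervalIntegrable_abel_kernel {p : ℝ} (hp : 0 < p) {t : ℝ} (ht : 0 < t) :
    IntervalIntegrable (fun s => (t - s) ^ (p - 1)) volume 0 t := by
  simpa using intervalIntegrable_sub_rpow_mul_sub_rpow hp one_pos ht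

/-- Substituting u = t - s leaves a truncated Gamma integral. The factor l^(-p) makes the Abel
operator small in a norm weighted by exp(-l t). -/
theorem integral_abel_kernel_mul_exp_le {p l t : ℝ} (hp : 0 < p) (hl : 0 < l) (ht : 0 < t) :
    ∫ s in (0 : ℝ)..t, (t - s) ^ (p - 1) * Real.exp (l * s) ≤
      Real.exp (l * t) * ((1 / l) ^ p * Real.Gamma p) := by
  have e : ∫ s in (0 : ℝ)..t, (t - s) ^ (p - 1) * Real.exp (l * s) =
      Real.exp (l * t) * ∫ u in (0 : ℝ)..t, u ^ (p - 1) * Real.exp (-(l * u)) := by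
    have h := intervalIntegral.integral_comp_sub_left (a := 0) (b := t)
      (fun u => u ^ (p - 1) * Real.exp (-(l * u))) t
    rw [sub_self, sub_zero] at h
    rw [← h, ← intervalIntegral.integral_const_mul]
    refine intervalIntegral.integral_congr fun s _ => ?_
    rw [mul_left_comm, ← Real.exp_add]
    ring_nf
  rw [e, ← Real.integral_rpow_mul_exp_neg_mul_Ioi hp hl, intervalIntegral.integral_of_le ht.le]
  refine mul_le_mul_of_nonneg_left ?_ (Real.exp_pos _).le
  refine setIntegral_mono_set ?_ ?_ (.of_forall Ioc_subset_Ioi_self)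
  · apply Integrable.of_integral_ne_zero
    rw [Real.integral_rpow_mul_exp_neg_mul_Ioi hp hl]
    have := Real.Gamma_pos_of_pos hp
    positivity
  · filter_upwards [ae_restrict_mem measurableSet_Ioi] with u hu
    exact mul_nonneg (Real.rpow_nonneg (le_of_lt hu) _) (Real.exp_pos _).le

/-- A homogeneous **Gronwall inequality** with a weakly singular kernel. -/
theorem eqOn_zero_of_le_integral_abel_kernel {p C T : ℝ} (hp : 0 < p) (hC : 0 ≤ C)
    {d : ℝ → ℝ} (hd : ContinuousOn d (Icc 0 T)) (hd0 : d 0 = 0) (hnn : ∀ t ∈ Icc 0 T, 0 ≤ d t)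
    (hle : ∀ t ∈ Ioc 0 T, d t ≤ C * ∫ s in (0 : ℝ)..t, (t - s) ^ (p - 1) * d s) :
    ∀ t ∈ Icc 0 T, d t = 0 := by
  intro t₁ ht₁
  set D := C * Real.Gamma p with hD
  have hΓ := Real.Gamma_pos_of_pos hp
  have hD0 : 0 ≤ D := by positivity
  -- Chosen so that D * l^(-p) = D / (2D + 1) < 1; the added 1 keeps l positive when D = 0.
  set l : ℝ := (2 * D + 1) ^ (1 / p) with hl
  have hl0 : 0 < l := by positivity
  have hlp : (1 / l) ^ p = 1 / (2 * D + 1) := by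
    rw [Real.div_rpow one_pos.le hl0.le, hl, ← Real.rpow_mul (by positivity),
      one_div_mul_cancel hp.ne', Real.rpow_one, Real.one_rpow]
  obtain ⟨t, ht, hmax⟩ := isCompact_Icc.exists_isMaxOn ⟨t₁, ht₁⟩
    (f := fun t => Real.exp (-(l * t)) * d t)
    ((by fun_prop : Continuous fun t => Real.exp (-(l * t))).continuousOn.mul hd)
  set M := Real.exp (-(l * t)) * d t with hM
  have hM0 : 0 ≤ M := mul_nonneg (Real.exp_pos _).le (hnn t ht)
  have hdM (s : ℝ) (hs : s ∈ Icc 0 T) : d s ≤ M * Real.exp (l * s) := by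
    have h := mul_le_mul_of_nonneg_right (hmax hs) (Real.exp_pos (l * s)).le
    dsimp only at h
    rw [mul_right_comm, ← Real.exp_add, neg_add_cancel, Real.exp_zero, one_mul] at h
    exact h
  suffices hMz : M ≤ 0 by
    have h := hdM t₁ ht₁
    rw [le_antisymm hMz hM0, zero_mul] at h
    exact le_antisymm h (hnn t₁ ht₁)
  -- The integral inequality is assumed only for positive times; a maximum at 0 is settled by `hd0`.
  rcases ht.1.eq_or_lt with h0 | h0
  · rw [hM, ← h0, hd0, mul_zero]
  have hK := intervalIntegrable_abel_kernel hp h0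
  have h1 : ∫ s in (0 : ℝ)..t, (t - s) ^ (p - 1) * d s ≤
      ∫ s in (0 : ℝ)..t, M * ((t - s) ^ (p - 1) * Real.exp (l * s)) := by
    refine intervalIntegral.integral_mono_on h0.le (hK.mul_continuousOn ?_)
      ((hK.mul_continuousOn (by fun_prop)).const_mul M) fun s hs => ?_
    · rw [uIcc_of_le h0.le]
      exact hd.mono (Icc_subset_Icc_right ht.2)
    · rw [mul_left_comm]
      exact mul_le_mul_of_nonneg_left (hdM s ⟨hs.1, hs.2.trans ht.2⟩)
        (Real.rpow_nonneg (sub_nonneg.2 hs.2) _)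
  rw [intervalIntegral.integral_const_mul] at h1
  have h2 : d t ≤ C * (M * (Real.exp (l * t) * (1 / (2 * D + 1) * Real.Gamma p))) := by
    refine (hle t ⟨h0, ht.2⟩).trans (mul_le_mul_of_nonneg_left (h1.trans ?_) hC)
    rw [← hlp]
    exact mul_le_mul_of_nonneg_left (integral_abel_kernel_mul_exp_le hp hl0 h0) hM0
  have h3 : M ≤ M * (D / (2 * D + 1)) := by
    calc M ≤ Real.exp (-(l * t)) *
          (C * (M * (Real.exp (l * t) * (1 / (2 * D + 1) * Real.Gamma p)))) :=
          mul_le_mul_of_nonneg_left h2 (Real.exp_pos _).le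
      _ = (Real.exp (-(l * t)) * Real.exp (l * t)) * (M * (D / (2 * D + 1))) := by
          rw [hD]; ring
      _ = M * (D / (2 * D + 1)) := by
          rw [← Real.exp_add, neg_add_cancel, Real.exp_zero, one_mul]
  rw [← mul_div_assoc, le_div_iff₀ (by positivity)] at h3
  nlinarith

theorem contDiff_todaField (k : ℝ) : ContDiff ℝ 1 (todaField k) := by
  rw [contDiff_pi]
  intro i
  fin_cases i <;> simp [todaField] <;> fun_prop

theorem IsTodaSolution.continuousOn {q k : ℝ} {x₀ : Fin 3 → ℝ} {T : ℝ} {x : ℝ → Fin 3 → ℝ}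
    (h : IsTodaSolution q k x₀ T x) {t : ℝ} (ht : t ∈ Ioo 0 T) : ContinuousOn x (Icc 0 t) := by
  refine continuousOn_pi.2 fun i => ?_
  simpa [uIcc_of_le ht.1.le] using (h.absCont i t ht).continuousOn

theorem IsTodaSolution.eq_add_rlIntegral {q k : ℝ} (hq0 : 0 < q) (hq1 : q < 1) {x₀ : Fin 3 → ℝ}
    {T : ℝ} {x : ℝ → Fin 3 → ℝ} (h : IsTodaSolution q k x₀ T x) {t : ℝ} (ht : t ∈ Ioo 0 T)
    (i : Fin 3) : x t i = x₀ i + rlIntegral q (fun s => todaField k (x s) i) t := by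
  have := (h.absCont i t ht).rlIntegral_caputo hq0 hq1 ht.1
    (fun s hs => h.eqn i s ⟨hs.1, hs.2.trans ht.2⟩)
  rw [this, h.init]
  ring

/-- On a compact interval both trajectories stay in one ball, on which the C¹ field is Lipschitz.
Subtracting the two Volterra equations in the sup metric gives the Gronwall hypothesis. -/
theorem IsTodaSolution.eqOn {q k : ℝ} (hq0 : 0 < q) (hq1 : q < 1) {x₀ : Fin 3 → ℝ}
    {T : ℝ} {x y : ℝ → Fin 3 → ℝ} (hx : IsTodaSolution q k x₀ T x)
    (hy : IsTodaSolution q k x₀ T y) : EqOn x y (Ico 0 T) := by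
  intro t₁ ht₁
  rcases ht₁.1.eq_or_lt with h0 | h0
  · rw [← h0, hx.init, hy.init]
  have hcx := hx.continuousOn ⟨h0, ht₁.2⟩
  have hcy := hy.continuousOn ⟨h0, ht₁.2⟩
  obtain ⟨r, hr⟩ := ((isCompact_Icc.image_of_continuousOn hcx).union
    (isCompact_Icc.image_of_continuousOn hcy)).isBounded.subset_closedBall 0
  obtain ⟨L, hL⟩ := (contDiff_todaField k).contDiffOn.exists_lipschitzOnWith one_ne_zero
    (convex_closedBall (0 : Fin 3 → ℝ) r) (isCompact_closedBall 0 r)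
  have hLd (s : ℝ) (hs : s ∈ Icc 0 t₁) (i : Fin 3) :
      |todaField k (x s) i - todaField k (y s) i| ≤ L * dist (x s) (y s) :=
    (dist_le_pi_dist (todaField k (x s)) (todaField k (y s)) i).trans
      (hL.dist_le_mul _ (hr (.inl ⟨s, hs, rfl⟩)) _ (hr (.inr ⟨s, hs, rfl⟩)))
  have hΓ := Real.Gamma_pos_of_pos hq0
  have hd := eqOn_zero_of_le_integral_abel_kernel (C := 1 / Real.Gamma q * L) (T := t₁)
    (d := fun s => dist (x s) (y s)) hq0 (by positivity) (continuous_dist.comp_continuousOn (hcx.prodMk hcy))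
    (by simp [hx.init, hy.init]) (fun _ _ => dist_nonneg) ?_ t₁ (right_mem_Icc.2 h0.le)
  · exact dist_eq_zero.1 hd
  intro t ht
  have htT : t ∈ Ioo 0 T := ⟨ht.1, ht.2.trans_lt ht₁.2⟩
  have hsub : Icc 0 t ⊆ Icc 0 t₁ := Icc_subset_Icc_right ht.2
  have hK := intervalIntegrable_abel_kernel hq0 ht.1
  have hF {z : ℝ → Fin 3 → ℝ} (hz : ContinuousOn z (Icc 0 t₁)) (i : Fin 3) :
      IntervalIntegrable (fun s => (t - s) ^ (q - 1) * todaField k (z s) i) volume 0 t := by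
    refine hK.mul_continuousOn ?_
    rw [uIcc_of_le ht.1.le]
    exact (continuous_apply i).comp_continuousOn
      ((contDiff_todaField k).continuous.comp_continuousOn (hz.mono hsub))
  have hdist : 0 ≤ ∫ s in (0 : ℝ)..t, (t - s) ^ (q - 1) * dist (x s) (y s) :=
    intervalIntegral.integral_nonneg ht.1.le fun s hs =>
      mul_nonneg (Real.rpow_nonneg (sub_nonneg.2 hs.2) _) dist_nonneg
  refine (dist_pi_le_iff (by positivity)).2 fun i => ?_
  rw [hx.eq_add_rlIntegral hq0 hq1 htT, hy.eq_add_rlIntegral hq0 hq1 htT, dist_add_left,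
    Real.dist_eq, rlIntegral, rlIntegral, ← mul_sub, abs_mul, abs_of_pos (by positivity),
    mul_assoc, ← intervalIntegral.integral_sub (hF hcx i) (hF hcy i),
    ← intervalIntegral.integral_const_mul]
  refine mul_le_mul_of_nonneg_left ?_ (by positivity)
  rw [← Real.norm_eq_abs]
  refine intervalIntegral.norm_integral_le_of_norm_le ht.1.le ?_ ?_
  · refine .of_forall fun s hs => ?_
    have hs' : 0 ≤ (t - s) ^ (q - 1) := Real.rpow_nonneg (sub_nonneg.2 hs.2) _
    rw [← mul_sub, norm_mul, Real.norm_of_nonneg hs', mul_left_comm]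
    exact mul_le_mul_of_nonneg_left (hLd s (hsub ⟨hs.1.le, hs.2⟩) i) hs'
  · refine (hK.mul_continuousOn ?_).const_mul _
    rw [uIcc_of_le ht.1.le]
    exact (continuous_dist.comp_continuousOn (hcx.prodMk hcy)).mono hsub

/-! ### Termwise fractional calculus of power series in t^q. -/

theorem integral_abel_kernel_mul_rpow {p m t : ℝ} (hp : 0 < p) (hm : 0 < m) (ht : 0 < t) :
    ∫ s in (0 : ℝ)..t, (t - s) ^ (p - 1) * s ^ (m - 1) = beta p m * t ^ (p + m - 1) := by
  simpa using integral_sub_rpow_mul_sub_rpow hp hm ht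

theorem intervalIntegrable_abel_kernel_mul_rpow {p m t : ℝ} (hp : 0 < p) (hm : 0 < m)
    (ht : 0 < t) : IntervalIntegrable (fun s => (t - s) ^ (p - 1) * s ^ (m - 1)) volume 0 t := by
  simpa using intervalIntegrable_sub_rpow_mul_sub_rpow hp hm ht

/-- Termwise integration of a generalized power series against an Abel kernel. -/
theorem hasSum_integral_abel_kernel_mul_tsum_rpow {p t : ℝ} (hp : 0 < p) (ht : 0 < t)
    {c m : ℕ → ℝ} (hm : ∀ n, 0 < m n)
    (hc : Summable fun n => |c n| * (beta p (m n) * t ^ (p + m n - 1))) :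
    IntervalIntegrable (fun s => (t - s) ^ (p - 1) * ∑' n, c n * s ^ (m n - 1)) volume 0 t ∧
      HasSum (fun n => c n * (beta p (m n) * t ^ (p + m n - 1)))
        (∫ s in (0 : ℝ)..t, (t - s) ^ (p - 1) * ∑' n, c n * s ^ (m n - 1)) := by
  let F : ℕ → ℝ → ℝ := fun n s => c n * ((t - s) ^ (p - 1) * s ^ (m n - 1))
  have hF (s : ℝ) : (t - s) ^ (p - 1) * ∑' n, c n * s ^ (m n - 1) = ∑' n, F n s := by
    rw [← tsum_mul_left]
    exact tsum_congr fun n => mul_left_comm _ _ _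
  have hint (n : ℕ) : Integrable (F n) (volume.restrict (Ioc 0 t)) :=
    ((intervalIntegrable_iff_integrableOn_Ioc_of_le ht.le).1
      (intervalIntegrable_abel_kernel_mul_rpow hp (hm n) ht)).const_mul (c n)
  have hval (n : ℕ) : ∫ s in Ioc 0 t, (t - s) ^ (p - 1) * s ^ (m n - 1) =
      beta p (m n) * t ^ (p + m n - 1) := by
    rw [← integral_abel_kernel_mul_rpow hp (hm n) ht, intervalIntegral.integral_of_le ht.le]
  have hnorm : Summable fun n => ∫ s in Ioc 0 t, ‖F n s‖ := by
    refine hc.congr fun n => ?_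
    rw [← hval n, ← integral_const_mul]
    refine setIntegral_congr_fun measurableSet_Ioc fun s hs => ?_
    have : 0 ≤ (t - s) ^ (p - 1) * s ^ (m n - 1) :=
      mul_nonneg (Real.rpow_nonneg (sub_nonneg.2 hs.2) _) (Real.rpow_nonneg hs.1.le _)
    simp only [F]
    rw [norm_mul, Real.norm_of_nonneg this, Real.norm_eq_abs]
  simp_rw [hF]
  rw [intervalIntegrable_iff_integrableOn_Ioc_of_le ht.le, intervalIntegral.integral_of_le ht.le]
  refine ⟨integrable_tsum_of_summable_integral_norm hint hnorm, ?_⟩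
  convert! hasSum_integral_of_summable_integral_norm hint hnorm using 2 with n
  rw [← hval n, ← integral_const_mul]

theorem beta_le_beta_one {a b : ℝ} (ha : 1 ≤ a) (hb : 0 < b) : beta a b ≤ beta 1 b := by
  have h (a : ℝ) (ha : 0 < a) := integral_abel_kernel_mul_rpow ha hb one_pos
  have ha' : 0 < a := one_pos.trans_le ha
  simp only [Real.one_rpow, mul_one] at h
  rw [← h a ha', ← h 1 one_pos]
  refine intervalIntegral.integral_mono_on zero_le_one
    (intervalIntegrable_abel_kernel_mul_rpow ha' hb one_pos)
    (intervalIntegrable_abel_kernel_mul_rpow one_pos hb one_pos) fun s hs => ?_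
  refine mul_le_mul_of_nonneg_right ?_ (Real.rpow_nonneg hs.1 _)
  rw [sub_self, Real.rpow_zero]
  exact Real.rpow_le_one (sub_nonneg.2 hs.2) (by linarith [hs.1]) (sub_nonneg.2 ha)

/-- The factor by which the Riemann-Liouville integral of order `q` multiplies `t ^ (n * q)`,
besides raising the exponent to `(n + 1) * q`. -/
noncomputable def rlRatio (q : ℝ) (n : ℕ) : ℝ :=
  Real.Gamma (n * q + 1) / Real.Gamma ((n + 1) * q + 1)

theorem rlRatio_pos {q : ℝ} (hq : 0 < q) (n : ℕ) : 0 < rlRatio q n :=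
  div_pos (Real.Gamma_pos_of_pos (by positivity)) (Real.Gamma_pos_of_pos (by positivity))

/-- The ratio is B(nq + 1, q) / Γ(q), and B(a, q) is largest at a = 1 among a ≥ 1. This uniform
bound keeps the coefficient recursion under control. -/
theorem rlRatio_le {q : ℝ} (hq : 0 < q) (n : ℕ) : rlRatio q n ≤ rlRatio q 0 := by
  have hΓ := Real.Gamma_pos_of_pos hq
  have h (m : ℕ) : rlRatio q m = beta (m * q + 1) q / Real.Gamma q := by
    rw [rlRatio, beta, show (m : ℝ) * q + 1 + q = (m + 1) * q + 1 by ring]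
    field_simp
  rw [h, h]
  have : (1 : ℝ) ≤ n * q + 1 := le_add_of_nonneg_left (by positivity)
  simpa using div_le_div_of_nonneg_right (beta_le_beta_one this hq) hΓ.le

/-- The termwise derivative of the fractional power series `∑ rlRatio q n * b n * t ^ ((n + 1) * q)`,
whose Caputo derivative of order `q` is `∑ b n * t ^ (n * q)`. -/
noncomputable def fracSeriesDeriv (q : ℝ) (b : ℕ → ℝ) (s : ℝ) : ℝ :=
  ∑' n : ℕ, b n * (Real.Gamma (n * q + 1) / Real.Gamma ((n + 1) * q)) * s ^ ((n + 1) * q - 1)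

/-- The case p = 1 of termwise integration, where the Abel kernel is constantly 1. -/
theorem hasSum_integral_fracSeriesDeriv {q t : ℝ} (hq : 0 < q) (ht : 0 < t) {b : ℕ → ℝ}
    (hb : Summable fun n => |b n| * (t ^ q) ^ n) :
    IntervalIntegrable (fracSeriesDeriv q b) volume 0 t ∧
      HasSum (fun n => rlRatio q n * b n * (t ^ q) ^ (n + 1))
        (∫ s in (0 : ℝ)..t, fracSeriesDeriv q b s) := by
  have hm (n : ℕ) : 0 < ((n : ℝ) + 1) * q := by positivity
  have hterm (n : ℕ) : Real.Gamma (n * q + 1) / Real.Gamma ((n + 1) * q) *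
      (beta 1 ((n + 1) * q) * t ^ (1 + (n + 1) * q - 1)) = rlRatio q n * (t ^ q) ^ (n + 1) := by
    have := (Real.Gamma_pos_of_pos (hm n)).ne'
    rw [beta, rlRatio, Real.Gamma_one, add_comm (1 : ℝ), add_sub_cancel_right, mul_comm _ q,
      ← Real.rpow_mul_natCast ht.le]
    push_cast
    rw [mul_comm q] at *
    field_simp
  have h := hasSum_integral_abel_kernel_mul_tsum_rpow one_pos ht (m := fun n => (n + 1) * q)
    (c := fun n => b n * (Real.Gamma (n * q + 1) / Real.Gamma ((n + 1) * q))) hm ?_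
  · simp only [sub_self, Real.rpow_zero, one_mul] at h
    refine ⟨h.1, ?_⟩
    convert! h.2 using 2 with n
    rw [mul_assoc (b n), hterm]
    ring
  · refine (hb.mul_left (rlRatio q 0 * t ^ q)).of_nonneg_of_le (fun n => ?_) fun n => ?_
    · have := beta_pos one_pos (hm n)
      positivity
    · have : 0 < Real.Gamma (n * q + 1) / Real.Gamma ((n + 1) * q) :=
        div_pos (Real.Gamma_pos_of_pos (by positivity)) (Real.Gamma_pos_of_pos (hm n))
      rw [abs_mul, abs_of_pos this, mul_assoc, hterm, pow_succ]
      calc |b n| * (rlRatio q n * ((t ^ q) ^ n * t ^ q))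
          = rlRatio q n * (t ^ q * (|b n| * (t ^ q) ^ n)) := by ring
        _ ≤ rlRatio q 0 * (t ^ q * (|b n| * (t ^ q) ^ n)) :=
          mul_le_mul_of_nonneg_right (rlRatio_le hq n) (by positivity)
        _ = _ := by ring

/-- The beta factor B(1 - q, (n + 1)q) cancels the Gamma quotient in the n-th term up to Γ(1 - q),
which the normalization of `rlIntegral` removes. -/
theorem rlIntegral_fracSeriesDeriv {q t : ℝ} (hq0 : 0 < q) (hq1 : q < 1) (ht : 0 < t) {b : ℕ → ℝ}
    (hb : Summable fun n => |b n| * (t ^ q) ^ n) :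
    IntervalIntegrable (fun s => (t - s) ^ ((1 - q) - 1) * fracSeriesDeriv q b s) volume 0 t ∧
      rlIntegral (1 - q) (fracSeriesDeriv q b) t = ∑' n, b n * (t ^ q) ^ n := by
  have hq1' : 0 < 1 - q := sub_pos.2 hq1
  have hΓ := Real.Gamma_pos_of_pos hq1'
  have hm (n : ℕ) : 0 < ((n : ℝ) + 1) * q := by positivity
  have hterm (n : ℕ) : Real.Gamma (n * q + 1) / Real.Gamma ((n + 1) * q) *
      (beta (1 - q) ((n + 1) * q) * t ^ ((1 - q) + (n + 1) * q - 1)) =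
        Real.Gamma (1 - q) * (t ^ q) ^ n := by
    have h1 := (Real.Gamma_pos_of_pos (hm n)).ne'
    have h2 : Real.Gamma (n * q + 1) ≠ 0 := (Real.Gamma_pos_of_pos (by positivity)).ne'
    rw [beta, show 1 - q + ((n : ℝ) + 1) * q = n * q + 1 by ring, add_sub_cancel_right,
      ← Real.rpow_mul_natCast ht.le, mul_comm q (n : ℝ)]
    field_simp
  have h := hasSum_integral_abel_kernel_mul_tsum_rpow hq1' ht (m := fun n => (n + 1) * q)
    (c := fun n => b n * (Real.Gamma (n * q + 1) / Real.Gamma ((n + 1) * q))) hm ?_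
  · refine ⟨h.1, ?_⟩
    change 1 / Real.Gamma (1 - q) * (∫ s in (0 : ℝ)..t, (t - s) ^ (1 - q - 1) *
      ∑' n : ℕ, b n * (Real.Gamma (n * q + 1) / Real.Gamma ((n + 1) * q)) *
        s ^ ((n + 1) * q - 1)) = _
    rw [← h.2.tsum_eq, ← tsum_mul_left]
    refine tsum_congr fun n => ?_
    rw [mul_assoc (b n), hterm]
    field_simp
  · refine (hb.mul_left (Real.Gamma (1 - q))).congr fun n => ?_
    have : 0 < Real.Gamma (n * q + 1) / Real.Gamma ((n + 1) * q) :=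
      div_pos (Real.Gamma_pos_of_pos (by positivity)) (Real.Gamma_pos_of_pos (hm n))
    rw [abs_mul, abs_of_pos this, mul_assoc, hterm]
    ring

/-- By Lebesgue differentiation the derivative of the primitive is h almost everywhere, and the
Caputo derivative sees it only under an integral. -/
theorem hasCaputoDerivAt_add_integral {q a t : ℝ} {h : ℝ → ℝ}
    (hh : IntervalIntegrable h volume 0 t)
    (hh' : IntervalIntegrable (fun s => (t - s) ^ ((1 - q) - 1) * h s) volume 0 t) :
    HasCaputoDerivAt q (fun s => a + ∫ u in (0 : ℝ)..s, h u) (rlIntegral (1 - q) h t) t := by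
  have hae : ∀ᵐ s, s ∈ uIoc 0 t → deriv (fun s => a + ∫ u in (0 : ℝ)..s, h u) s = h s := by
    filter_upwards [hh.ae_hasDerivAt_integral] with s hs hst
    exact ((hs (uIoc_subset_uIcc hst) 0 left_mem_uIcc).const_add a).deriv
  refine ⟨hh'.congr_ae ?_, ?_⟩
  · rw [Filter.EventuallyEq, ae_restrict_iff' measurableSet_uIoc]
    filter_upwards [hae] with s hs hst
    rw [hs hst]
  · rw [rlIntegral, rlIntegral]
    congr 1
    refine intervalIntegral.integral_congr_ae ?_
    filter_upwards [hae] with s hs hst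
    rw [hs hst]

theorem absolutelyContinuousOnInterval_add_integral {a t : ℝ} {h : ℝ → ℝ}
    (hh : IntervalIntegrable h volume 0 t) :
    AbsolutelyContinuousOnInterval (fun s => a + ∫ u in (0 : ℝ)..s, h u) 0 t :=
  AbsolutelyContinuousOnInterval.add
    ((LipschitzWith.const a).lipschitzOnWith (s := uIcc 0 t)).absolutelyContinuousOnInterval
    (hh.absolutelyContinuousOnInterval_intervalIntegral left_mem_uIcc)

/-! ### The coefficient recursion. -/

/-- The coefficients of `todaField k` applied to the power series with coefficients `a`. -/
noncomputable def todaCauchy (k : ℝ) (a : ℕ → Fin 3 → ℝ) (n : ℕ) : Fin 3 → ℝ :=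
  ![∑ j ∈ Finset.range (n + 1), a j 0 * (-a (n - j) 1 + a (n - j) 2),
    2 * ∑ j ∈ Finset.range (n + 1), a j 0 * a (n - j) 0,
    -2 * (∑ j ∈ Finset.range (n + 1), a j 0 * a (n - j) 0) - k * a n 2]

theorem todaCauchy_congr (k : ℝ) {a a' : ℕ → Fin 3 → ℝ} {n : ℕ} (h : ∀ j ≤ n, a j = a' j) :
    todaCauchy k a n = todaCauchy k a' n := by
  have h1 : ∑ j ∈ Finset.range (n + 1), a j 0 * (-a (n - j) 1 + a (n - j) 2) =
      ∑ j ∈ Finset.range (n + 1), a' j 0 * (-a' (n - j) 1 + a' (n - j) 2) :=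
    Finset.sum_congr rfl fun j hj => by
      rw [h j (Finset.mem_range_succ_iff.1 hj), h (n - j) (Nat.sub_le n j)]
  have h2 : ∑ j ∈ Finset.range (n + 1), a j 0 * a (n - j) 0 =
      ∑ j ∈ Finset.range (n + 1), a' j 0 * a' (n - j) 0 :=
    Finset.sum_congr rfl fun j hj => by
      rw [h j (Finset.mem_range_succ_iff.1 hj), h (n - j) (Nat.sub_le n j)]
  rw [todaCauchy, todaCauchy, h1, h2, h n le_rfl]

/-- The coefficients of the solution of the Toda problem as a power series in `t ^ q`. -/
noncomputable def todaCoeff (q k : ℝ) (x₀ : Fin 3 → ℝ) : ℕ → Fin 3 → ℝ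
  | 0 => x₀
  -- The cutoff makes termination visible; its default 0 is never read, since `todaCauchy` at n uses
  -- only indices up to n.
  | n + 1 => rlRatio q n • todaCauchy k (fun j => if j ≤ n then todaCoeff q k x₀ j else 0) n
decreasing_by omega

theorem todaCoeff_zero (q k : ℝ) (x₀ : Fin 3 → ℝ) : todaCoeff q k x₀ 0 = x₀ := by
  rw [todaCoeff]

theorem todaCoeff_succ (q k : ℝ) (x₀ : Fin 3 → ℝ) (n : ℕ) :
    todaCoeff q k x₀ (n + 1) = rlRatio q n • todaCauchy k (todaCoeff q k x₀) n := by
  rw [todaCoeff]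
  congr 1
  exact todaCauchy_congr k fun j hj => if_pos hj

theorem hasSum_cauchy_product_mul_pow {u v : ℕ → ℝ} {z : ℝ} (hu : Summable fun n => ‖u n * z ^ n‖)
    (hv : Summable fun n => ‖v n * z ^ n‖) :
    HasSum (fun n => (∑ j ∈ Finset.range (n + 1), u j * v (n - j)) * z ^ n)
      ((∑' n, u n * z ^ n) * ∑' n, v n * z ^ n) := by
  have h := (summable_norm_sum_mul_range_of_summable_norm hu hv).of_norm.hasSum
  rw [← tsum_mul_tsum_eq_tsum_sum_range_of_summable_norm hu hv] at h
  refine h.congr_fun fun n => ?_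
  rw [Finset.sum_mul]
  refine Finset.sum_congr rfl fun j hj => ?_
  rw [← Nat.add_sub_cancel' (Finset.mem_range_succ_iff.1 hj), pow_add, Nat.add_sub_cancel_left]
  ring

theorem hasSum_todaCauchy {k z : ℝ} {a : ℕ → Fin 3 → ℝ}
    (ha : ∀ i, Summable fun n => ‖a n i * z ^ n‖) (i : Fin 3) :
    HasSum (fun n => todaCauchy k a n i * z ^ n)
      (todaField k (fun i => ∑' n, a n i * z ^ n) i) := by
  have hs (i : Fin 3) := (ha i).of_norm
  have h00 := hasSum_cauchy_product_mul_pow (ha 0) (ha 0)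
  fin_cases i
  · have hv : Summable fun n => ‖(-a n 1 + a n 2) * z ^ n‖ :=
      ((ha 1).add (ha 2)).of_nonneg_of_le (fun _ => norm_nonneg _) fun n => by
        rw [add_mul, neg_mul]
        exact (norm_add_le _ _).trans_eq (by rw [norm_neg])
    have h := hasSum_cauchy_product_mul_pow (ha 0) hv
    have e : ∑' n, (-a n 1 + a n 2) * z ^ n = -(∑' n, a n 1 * z ^ n) + ∑' n, a n 2 * z ^ n := by
      rw [← tsum_neg, ← (hs 1).neg.tsum_add (hs 2)]
      exact tsum_congr fun n => by ring
    rw [e] at h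
    simpa [todaCauchy, todaField] using h
  · have h := h00.mul_left 2
    convert! h using 1
    · ext n
      simp [todaCauchy, mul_assoc]
    · simp [todaField, sq]
  · have h := (h00.mul_left (-2)).sub ((hs 2).hasSum.mul_left k)
    convert! h using 1
    · ext n
      simp [todaCauchy]
      ring
    · simp [todaField, sq]

/-! ### Catalan majorant for the coefficients. -/

theorem catalan_le_catalan_succ (n : ℕ) : catalan n ≤ catalan (n + 1) := by
  rw [catalan_succ]
  simpa using Finset.single_le_sum (f := fun i : Fin n.succ => catalan i * catalan (n - i))
    (fun _ _ => Nat.zero_le _) (Finset.mem_univ (Fin.last n))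

theorem catalan_le_four_pow (n : ℕ) : catalan n ≤ 4 ^ n := by
  rw [catalan_eq_centralBinom_div, Nat.centralBinom]
  refine (Nat.div_le_self _ _).trans ((Nat.choose_le_two_pow _ _).trans_eq ?_)
  rw [pow_mul]
  norm_num

/-- A purely geometric bound would lose a factor n + 1 in each convolution; the Catalan recurrence
absorbs the sum exactly. The linear control term fits because A ≤ A² and Catalan numbers do not
decrease. -/
theorem abs_todaCauchy_le {k A B : ℝ} (hA : 1 ≤ A) (hB : 0 ≤ B) {a : ℕ → Fin 3 → ℝ} {n : ℕ}
    (h : ∀ j ≤ n, ∀ i, |a j i| ≤ A * B ^ j * catalan j) (i : Fin 3) :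
    |todaCauchy k a n i| ≤ (2 + |k|) * A ^ 2 * B ^ n * catalan (n + 1) := by
  have hA0 : 0 ≤ A := zero_le_one.trans hA
  have hsum {v : ℕ → ℝ} {c : ℝ} (hv : ∀ j ≤ n, |v j| ≤ c * (A * B ^ j * catalan j)) :
      |∑ j ∈ Finset.range (n + 1), a j 0 * v (n - j)| ≤
        c * A ^ 2 * B ^ n * catalan (n + 1) := by
    rw [catalan_succ, Fin.sum_univ_eq_sum_range (fun j => catalan j * catalan (n - j)) n.succ,
      Nat.cast_sum, Finset.mul_sum]
    refine (Finset.abs_sum_le_sum_abs _ _).trans (Finset.sum_le_sum fun j hj => ?_)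
    have hj' := Finset.mem_range_succ_iff.1 hj
    rw [abs_mul]
    refine (mul_le_mul (h j hj' 0) (hv (n - j) (Nat.sub_le n j)) (abs_nonneg _)
      (by positivity)).trans_eq ?_
    rw [← pow_mul_pow_sub B hj']
    push_cast
    ring
  have h0 := hsum (v := fun j => a j 0) (c := 1) fun j hj => by simpa using h j hj 0
  have hpos : 0 ≤ A ^ 2 * B ^ n * (catalan (n + 1) : ℝ) := by positivity
  have hk := mul_nonneg (abs_nonneg k) hpos
  fin_cases i
  · have h1 := hsum (v := fun j => -a j 1 + a j 2) (c := 2) fun j hj => by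
      refine (abs_add_le _ _).trans ?_
      rw [abs_neg]
      linarith [h j hj 1, h j hj 2]
    simp only [todaCauchy, Fin.zero_eta, Matrix.cons_val_zero]
    linarith
  · simp only [todaCauchy, Fin.mk_one, Matrix.cons_val_one, Matrix.cons_val_zero, abs_mul, abs_two]
    linarith
  · have h2 : |a n 2| ≤ A ^ 2 * B ^ n * catalan (n + 1) := by
      refine (h n le_rfl 2).trans ?_
      gcongr
      · nlinarith
      · exact catalan_le_catalan_succ n
    have h3 := mul_le_mul_of_nonneg_left h2 (abs_nonneg k)
    simp only [todaCauchy, Fin.reduceFinMk, Matrix.cons_val]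
    refine (abs_sub _ _).trans ?_
    rw [abs_mul, abs_mul, abs_neg, abs_two]
    linarith

theorem exists_todaCoeff_bound {q : ℝ} (hq : 0 < q) (k : ℝ) (x₀ : Fin 3 → ℝ) :
    ∃ A B : ℝ, 0 ≤ B ∧ ∀ n i, |todaCoeff q k x₀ n i| ≤ A * B ^ n ∧
      |todaCauchy k (todaCoeff q k x₀) n i| ≤ A * B ^ n := by
  set A : ℝ := max 1 ‖x₀‖ with hA
  have hA1 : 1 ≤ A := le_max_left _ _
  have hr := rlRatio_pos hq 0
  -- Makes the induction close: `rlRatio q 0` * (2 + |k|) * A² * B^n = A * B^(n + 1).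
  set B : ℝ := rlRatio q 0 * (2 + |k|) * A with hB
  have hB0 : 0 ≤ B := by positivity
  have key (n : ℕ) : ∀ i, |todaCoeff q k x₀ n i| ≤ A * B ^ n * catalan n := by
    induction n using Nat.strong_induction_on with
    | _ n ih =>
      intro i
      cases n with
      | zero =>
        rw [todaCoeff_zero, pow_zero, mul_one, catalan_zero, Nat.cast_one, mul_one]
        exact (norm_le_pi_norm x₀ i).trans (le_max_right _ _)
      | succ n =>
        have h := abs_todaCauchy_le (k := k) hA1 hB0
          (fun j hj => ih j (Nat.lt_succ_of_le hj)) i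
        rw [todaCoeff_succ, Pi.smul_apply, smul_eq_mul, abs_mul, abs_of_pos (rlRatio_pos hq n)]
        refine (mul_le_mul (rlRatio_le hq n) h (abs_nonneg _) hr.le).trans_eq ?_
        rw [pow_succ B]
        nth_rw 3 [hB]
        ring
  have hcat (n : ℕ) : (catalan n : ℝ) ≤ 4 ^ n := by exact_mod_cast catalan_le_four_pow n
  -- Catalan numbers are at most 4^n, hence 4 * B; the extra 4 in front pays for the index n + 1 in
  -- the bound on `todaCauchy`.
  refine ⟨4 * (2 + |k|) * A ^ 2, 4 * B, by positivity, fun n i => ⟨?_, ?_⟩⟩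
  · refine (key n i).trans ?_
    rw [mul_pow 4 B]
    have h1 : A ≤ 4 * (2 + |k|) * A ^ 2 := by
      nlinarith [abs_nonneg k, mul_nonneg (abs_nonneg k) (sq_nonneg A)]
    calc A * B ^ n * catalan n ≤ (4 * (2 + |k|) * A ^ 2) * B ^ n * 4 ^ n := by
          gcongr
          exact hcat n
      _ = _ := by ring
  · refine (abs_todaCauchy_le hA1 hB0 (fun j _ => key j) i).trans ?_
    calc (2 + |k|) * A ^ 2 * B ^ n * catalan (n + 1)
        ≤ (2 + |k|) * A ^ 2 * B ^ n * 4 ^ (n + 1) := by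
          gcongr
          exact hcat (n + 1)
      _ = _ := by rw [mul_pow 4 B]; ring

/-! ### Local existence. -/

theorem exists_isTodaSolution {q : ℝ} (hq0 : 0 < q) (hq1 : q < 1) (k : ℝ) (x₀ : Fin 3 → ℝ) :
    ∃ τ : ℝ, 0 < τ ∧ ∃ x : ℝ → Fin 3 → ℝ, IsTodaSolution q k x₀ τ x := by
  obtain ⟨A, B, hB, hbound⟩ := exists_todaCoeff_bound hq0 k x₀
  set a := todaCoeff q k x₀ with ha
  -- So τ^q = 1 / (B + 1), and B * t^q < 1 for t < τ even when B = 0.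
  set τ : ℝ := (1 / (B + 1)) ^ (1 / q) with hτ
  have hgeom {t : ℝ} (ht : t ∈ Ioo 0 τ) {c : ℕ → ℝ} (hc : ∀ n, |c n| ≤ A * B ^ n) :
      Summable fun n => |c n| * (t ^ q) ^ n := by
    have htq : 0 ≤ t ^ q := Real.rpow_nonneg ht.1.le _
    have hlt : t ^ q < 1 / (B + 1) := by
      have h := Real.rpow_lt_rpow ht.1.le ht.2 hq0
      rwa [hτ, ← Real.rpow_mul (by positivity), one_div_mul_cancel hq0.ne', Real.rpow_one] at h
    have hlt' : B * t ^ q < 1 := by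
      rw [lt_div_iff₀ (by positivity)] at hlt
      linarith
    refine ((summable_geometric_of_lt_one (by positivity) hlt').mul_left A).of_nonneg_of_le
      (fun n => by positivity) fun n => ?_
    rw [mul_pow, ← mul_assoc]
    exact mul_le_mul_of_nonneg_right (hc n) (by positivity)
  set b : Fin 3 → ℕ → ℝ := fun i n => todaCauchy k a n i with hb
  have hsb {t : ℝ} (ht : t ∈ Ioo 0 τ) (i : Fin 3) := hgeom ht (c := b i) fun n => (hbound n i).2
  -- Written as a primitive, the witness has its initial value and absolute continuity built in;
  -- `hval` identifies it with the power series in t^q.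
  refine ⟨τ, by positivity, fun t i => x₀ i + ∫ s in (0 : ℝ)..t, fracSeriesDeriv q (b i) s,
    fun i t ht => ?_, by simp, fun i t ht => ?_⟩
  · exact absolutelyContinuousOnInterval_add_integral
      (hasSum_integral_fracSeriesDeriv hq0 ht.1 (hsb ht i)).1
  · have hsa (i : Fin 3) : Summable fun n => ‖a n i * (t ^ q) ^ n‖ := by
      refine (hgeom ht fun n => (hbound n i).1).congr fun n => ?_
      rw [norm_mul, Real.norm_eq_abs,
        Real.norm_of_nonneg (pow_nonneg (Real.rpow_nonneg ht.1.le _) n)]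
    have hval (i : Fin 3) : x₀ i + ∫ s in (0 : ℝ)..t, fracSeriesDeriv q (b i) s =
        ∑' n, a n i * (t ^ q) ^ n := by
      rw [(hsa i).of_norm.tsum_eq_zero_add,
        ← (hasSum_integral_fracSeriesDeriv hq0 ht.1 (hsb ht i)).2.tsum_eq]
      simp [ha, hb, todaCoeff_zero, todaCoeff_succ]
    obtain ⟨h1, h2⟩ := rlIntegral_fracSeriesDeriv hq0 hq1 ht.1 (hsb ht i)
    convert! hasCaputoDerivAt_add_integral
      (hasSum_integral_fracSeriesDeriv hq0 ht.1 (hsb ht i)).1 h1 using 1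
    rw [h2, (hasSum_todaCauchy hsa i).tsum_eq]
    simp_rw [hval]

/-- A solution exists on some interval `[0, τ)` with `τ > 0`, and any two solutions on the same
interval `[0, T)` coincide there. -/
theorem proposition3p1 (q : ℝ) (hq0 : 0 < q) (hq1 : q < 1) (k : ℝ) (hk : k ≠ 0)
    (x₀ : Fin 3 → ℝ) :
    (∃ τ : ℝ, 0 < τ ∧ ∃ x : ℝ → Fin 3 → ℝ, IsTodaSolution q k x₀ τ x) ∧
    (∀ T : ℝ, 0 < T → ∀ x y : ℝ → Fin 3 → ℝ,
      IsTodaSolution q k x₀ T x → IsTodaSolution q k x₀ T y →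
        Set.EqOn x y (Set.Ico 0 T)) :=
  ⟨exists_isTodaSolution hq0 hq1 k x₀, fun _ _ _ _ hx hy => hx.eqOn hq0 hq1 hy⟩
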